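/- **Processes.** Let $\mathcal L,\mathcal R,\mathcal N$ be sets of labels $l$, roles $r,s,q$ and channels $a,b,c$. A qualified role $\rho,\sigma$ is an authorized role $\hat r$ or an unauthorized role $\check r$ ($r\in\mathcal R$); $|\rho|$ denotes its underlying role. Processes, up to renaming of bound channels, are $$P::=0\mid P\,|\,P\mid(\nu a)P\mid a!\rho\,l(b).P\mid a?\rho\,l(b).P\mid a!\rho\,l(\sigma).P\mid a?\rho\,l(r).P ,$$ where $(\nu a)P$ binds $a$ in $P$ and the channel input $a?\rho\,l(b).P$ binds $b$ in $P$. Structural congruence $\equiv$ is the least congruence such that $|$ is commutative and associative with unit $0$, $(\nu a)0\equiv0$, $(\nu a)(\nu b)P\equiv(\nu b)(\nu a)P$, and $(\nu a)P\,|\,Q\equiv(\nu a)(P\,|\,Q)$ for $a$ not free in $Q$. Reduction $\to$ is the least relation that is closed under $|$, $(\nu a)$ and $\equiv$ and contains $$a!\hat s\,l(b).P\,|\,a?\hat r\,l(c).Q\to P\,|\,Q\{b/c\},\qquad a!\hat s\,l(\hat q).P\,|\,a?\hat r\,l(q).Q\to P\,|\,Q\,a{:}\{\hat q/\check q\},$$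 where $a{:}\{\hat q/\check q\}$ replaces $\check q$ by $\hat q$ in the subjects of all prefixes on channel $a$ and in all qualified roles sent on channel $a$. $\to^*$ is its reflexive and transitive closure. A prefix is *unauthorized* if it has one of the forms $a?\check r\,l(b)$, $a!\check r\,l(b)$, $a?\check r\,l(s)$, $a!\check r\,l(\hat s)$, $a!\sigma\,l(\check s)$. A process is an *authorization error* if it is structurally congruent to $(\nu a_1)\cdots(\nu a_n)(\alpha.Q'\,|\,R)$ for some $n\ge0$, $a_1,\dots,a_n$, $Q'$, $R$ and some unauthorized prefix $\alpha$. **Types.** Behavioral types $B$, shared channel types $T$, message types $M$ and polarities $p$ are $$B::=\mathsf{end}\mid B|B\mid\Diamond B\mid p\,l(M).B,\quad T::=l(B),\quad M::=B\mid T\mid r,\quad p::=\,!r\mid{?r}\mid r\to s .$$ The labels of $B$ are those of its prefixes (not those inside message types); $B\#C$ means that $B$ and $C$ have disjoint label sets. $B$ is well formed if $B_1\#B_2$ whenever $B_1|B_2$ occurs in it (also inside message types), and whenever $\Diamond B'$ occurs in it, no prefix $r\to s\;l(M)$ of $B'$ is immediate (i.e. under no other prefix). $\mathsf{matched}(B)$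 holds if $B$ has no prefix with polarity $!r$ or $?r$ (message types not counted). $\equiv$ on types is the least equivalence relation that is a congruence for $|$, $\Diamond$ and $p\,l(M).\_$, such that $|$ is commutative and associative with unit $\mathsf{end}$, $\Diamond\mathsf{end}\equiv\mathsf{end}$, $\Diamond\Diamond B\equiv\Diamond B$ and $\Diamond(B|C)\equiv\Diamond B|\Diamond C$. Subtyping $<:$ is the least transitive relation that contains $\equiv$ and all $p\,l(M).B<:\Diamond\,p\,l(M).B$ with $p$ of the form $!r$ or $?r$, and is preserved by $|$, $\Diamond$ and $p\,l(M).\_$. Splitting $B=C\circ D$ is the least relation that is symmetric in $C,D$ and invariant under $\equiv$ in each of $B,C,D$, with: $B=B\circ\mathsf{end}$; and if $B=C\circ D$, then $\Diamond B=\Diamond C\circ\Diamond D$, $\;r\to s\;l(M).B=\,!r\,l(M).C\circ{?s}\,l(M).D$, $\;p\,l(M).B=p\,l(M).C\circ\Diamond D$ provided $l$ is not a label of $D$, and (if also $B'=C'\circ D'$) $B|B'=(C|C')\circ(D|D')$. **Typing.** $\Delta$ is a finite partial map from channels to well-formed behavioral types, $\Gamma$ one from channels to well-formed shared channel types; $\Delta$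 and $\Gamma$ have disjoint domains in every judgment. $\Delta=\Delta_1\circ\Delta_2$ means that, for each channel, either it is in none of the three domains, or it is in $\mathrm{dom}\,\Delta$ and exactly one of $\mathrm{dom}\,\Delta_1,\mathrm{dom}\,\Delta_2$ with the same type, or it is in all three and its types satisfy $B=B_1\circ B_2$. In a rule, $\Delta_1\circ\Delta_2$ stands for any such $\Delta$, and $\Delta,a:B$ requires $a\notin\mathrm{dom}\,\Delta$. Let $\Sigma,\Xi\subseteq\mathcal N\times\mathcal R$, let $\mathrm{ch}(\Sigma)$ be the first projection of $\Sigma$, $u(a,\check r)=\{(a,r)\}$ and $u(a,\hat r)=\emptyset$. The judgment $\Delta;\Gamma\vdash_\Sigma P$ is defined inductively by the following rules (bound names are chosen fresh): * $\Delta;\Gamma\vdash_\emptyset0$ if all types in $\Delta$ are $\equiv\mathsf{end}$. * $\Delta;\Gamma\vdash_\Sigma(\nu a)P$ if $\Delta;\Gamma,a:l(B)\vdash_\Sigma P$. * $\Delta;\Gamma\vdash_\Sigma(\nu a)P$ if $\Delta,a:B;\Gamma\vdash_\Sigma P$, $\mathsf{matched}(B)$ and $a\notin\mathrm{ch}(\Sigma)$.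 * $\Delta_1\circ\Delta_2;\Gamma\vdash_{\Sigma\cup\Xi}P|Q$ if $\Delta_1;\Gamma\vdash_\Sigma P$ and $\Delta_2;\Gamma\vdash_\Xi Q$. * $\Delta\circ a:B';\Gamma\vdash_{\Sigma\cup u(a,\rho)}a?\rho\,l(s).P$ if $\Delta\circ a:B;\Gamma\vdash_{\Sigma\cup\{(a,s)\}}P$ and $?|\rho|\,l(s).B<:B'$. * $\Delta\circ a:B';\Gamma\vdash_{\Sigma\cup u(a,\rho)\cup u(a,\sigma)}a!\rho\,l(\sigma).P$ if $\Delta\circ a:B;\Gamma\vdash_\Sigma P$ and $!|\rho|\,l(|\sigma|).B<:B'$. * $\Delta\circ a:B'';\Gamma\vdash_{\Sigma\cup u(a,\rho)}a?\rho\,l(b).P$ if $(\Delta\circ a:B),b:B';\Gamma\vdash_\Sigma P$, $?|\rho|\,l(B').B<:B''$ and $b\notin\mathrm{ch}(\Sigma)$. * $(\Delta\circ a:B'')\circ b:B';\Gamma\vdash_{\Sigma\cup u(a,\rho)}a!\rho\,l(b).P$ if $\Delta\circ a:B;\Gamma\vdash_\Sigma P$ and $!|\rho|\,l(B').B<:B''$.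 * $\Delta\circ a:B;\Gamma\vdash_{\Sigma\cup u(a,\rho)}a?\rho\,l(b).P$ if $\Delta\circ a:B';\Gamma,b:T\vdash_\Sigma P$, $?|\rho|\,l(T).B'<:B$ and $b\notin\mathrm{ch}(\Sigma)$. * $\Delta\circ a:B;\Gamma,b:T\vdash_{\Sigma\cup u(a,\rho)}a!\rho\,l(b).P$ if $\Delta\circ a:B';\Gamma,b:T\vdash_\Sigma P$ and $!|\rho|\,l(T).B'<:B$. * $\Delta;\Gamma,a:l(B)\vdash_\Sigma a?\hat r\,l(b).P$ if $\Delta,b:B;\Gamma,a:l(B)\vdash_\Sigma P$ and $b\notin\mathrm{ch}(\Sigma)$. * $\Delta\circ b:B;\Gamma,a:l(B)\vdash_\Sigma a!\hat r\,l(b).P$ if $\Delta;\Gamma,a:l(B)\vdash_\Sigma P$. $P$ is *well typed* if $\Delta;\Gamma\vdash_\emptyset P$ for some $\Delta$ and $\Gamma$. **Corollary (Type safety).** If $P$ is a well-typed process and $P\to^*Q$, then $Q$ is not an authorization error. -/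

import Mathlib

universe u v w

namespace RoleAuth

/-! ## Processes -/

/-- A qualified role `ρ`: authorized or unauthorized. -/
inductive QRole (R : Type v) : Type v
  | auth (r : R) : QRole R
  | unauth (r : R) : QRole R

namespace QRole

/-- The underlying role. -/
def role {R : Type v} : QRole R → R
  | auth r => r
  | unauth r => r

/-- The qualification is "unauthorized". -/
def IsUnauth {R : Type v} : QRole R → Prop
  | auth _ => False
  | unauth _ => True

open Classical in
/-- Replace the unauthorized role `q` by the authorized role `q`, and keep every other
qualified role. -/
noncomputable def authorize {R : Type v} (q : R) (ρ : QRole R) : QRole R :=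
  if ρ = unauth q then auth q else ρ

end QRole

/-- Processes over labels `L` and roles `R` with free channel names taken from `N`, up to renaming
of bound names: the scope of a binder is a process over `Option N`, in which `none` is the bound
name and `some a` is the outer name `a`. -/
inductive Proc (L : Type u) (R : Type v) : Type w → Type (max u v (w + 1))
  /-- inaction `0` -/
  | nil {N : Type w} : Proc L R N
  /-- parallel composition `P | Q` -/
  | par {N : Type w} (P Q : Proc L R N) : Proc L R N
  /-- restriction `(ν x) P` -/
  | res {N : Type w} (P : Proc L R (Option N)) : Proc L R N
  /-- `a!ρ l(b).P`: send the channel `b` -/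
  | send {N : Type w} (a : N) (ρ : QRole R) (l : L) (b : N) (P : Proc L R N) : Proc L R N
  /-- `a?ρ l(x).P`: receive a channel; `x` is bound in `P` -/
  | recv {N : Type w} (a : N) (ρ : QRole R) (l : L) (P : Proc L R (Option N)) : Proc L R N
  /-- `a!ρ l(σ).P`: send the qualified role `σ` -/
  | sendAuth {N : Type w} (a : N) (ρ : QRole R) (l : L) (σ : QRole R) (P : Proc L R N) :
      Proc L R N
  /-- `a?ρ l(r).P`: receive authorization for the role `r` (which is not bound) -/
  | recvAuth {N : Type w} (a : N) (ρ : QRole R) (l : L) (r : R) (P : Proc L R N) : Proc L R N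

namespace Proc

variable {L : Type u} {R : Type v}

/-- (Capture-avoiding) substitution of free names along `f`. -/
def map : {N N' : Type w} → (N → N') → Proc L R N → Proc L R N'
  | _, _, _, nil => nil
  | _, _, f, par P Q => par (P.map f) (Q.map f)
  | _, _, f, res P => res (P.map (Option.map f))
  | _, _, f, send a ρ l b P => send (f a) ρ l (f b) (P.map f)
  | _, _, f, recv a ρ l P => recv (f a) ρ l (P.map (Option.map f))
  | _, _, f, sendAuth a ρ l σ P => sendAuth (f a) ρ l σ (P.map f)
  | _, _, f, recvAuth a ρ l r P => recvAuth (f a) ρ l r (P.map f)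

/-- The process `P` placed in the scope of an additional bound name that it does not use. -/
def lift {N : Type w} (P : Proc L R N) : Proc L R (Option N) := P.map some

/-- `P{b/x}` for the outermost bound name `x`. -/
def subst {N : Type w} (P : Proc L R (Option N)) (b : N) : Proc L R N :=
  P.map (fun x => x.getD b)

/-- Exchange of the two innermost bound names. -/
def swapName {N : Type w} : Option (Option N) → Option (Option N)
  | none => some none
  | some none => none
  | some (some a) => some (some a)

open Classical in
/-- The qualification of `ρ`, occurring in a prefix on channel `c`, after the substitution
`a:{q/unauthorized q}`. -/
noncomputable def authorizeOn {N : Type w} (a : N) (q : R) (c : N) (ρ : QRole R) : QRole R :=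
  if c = a then ρ.authorize q else ρ

/-- The substitution `a:{q/unauthorized q}` of the authorized for the unauthorized role `q`, on the
channel `a` only: it acts on the subjects of the prefixes on `a` and on the qualified roles
that are sent on `a`. -/
noncomputable def authorize : {N : Type w} → N → R → Proc L R N → Proc L R N
  | _, _, _, nil => nil
  | _, a, q, par P Q => par (P.authorize a q) (Q.authorize a q)
  | _, a, q, res P => res (P.authorize (some a) q)
  | _, a, q, send c ρ l b P => send c (authorizeOn a q c ρ) l b (P.authorize a q)
  | _, a, q, recv c ρ l P => recv c (authorizeOn a q c ρ) l (P.authorize (some a) q)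
  | _, a, q, sendAuth c ρ l σ P =>
      sendAuth c (authorizeOn a q c ρ) l (authorizeOn a q c σ) (P.authorize a q)
  | _, a, q, recvAuth c ρ l r P => recvAuth c (authorizeOn a q c ρ) l r (P.authorize a q)

/-- Structural congruence `≡`. -/
inductive SCong : {N : Type w} → Proc L R N → Proc L R N → Prop
  | refl {N : Type w} (P : Proc L R N) : SCong P P
  | symm {N : Type w} {P Q : Proc L R N} : SCong P Q → SCong Q P
  | trans {N : Type w} {P Q S : Proc L R N} : SCong P Q → SCong Q S → SCong P S
  | par_nil {N : Type w} (P : Proc L R N) : SCong (par P nil) P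
  | par_comm {N : Type w} (P Q : Proc L R N) : SCong (par P Q) (par Q P)
  | par_assoc {N : Type w} (P Q S : Proc L R N) :
      SCong (par (par P Q) S) (par P (par Q S))
  | res_nil {N : Type w} : SCong (res (nil : Proc L R (Option N))) nil
  | res_swap {N : Type w} (P : Proc L R (Option (Option N))) :
      SCong (res (res P)) (res (res (P.map swapName)))
  | res_par {N : Type w} (P : Proc L R (Option N)) (Q : Proc L R N) :
      SCong (par (res P) Q) (res (par P Q.lift))
  | congr_par {N : Type w} {P P' Q Q' : Proc L R N} :
      SCong P P' → SCong Q Q' → SCong (par P Q) (par P' Q')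
  | congr_res {N : Type w} {P P' : Proc L R (Option N)} : SCong P P' → SCong (res P) (res P')
  | congr_send {N : Type w} (a : N) (ρ : QRole R) (l : L) (b : N) {P P' : Proc L R N} :
      SCong P P' → SCong (send a ρ l b P) (send a ρ l b P')
  | congr_recv {N : Type w} (a : N) (ρ : QRole R) (l : L) {P P' : Proc L R (Option N)} :
      SCong P P' → SCong (recv a ρ l P) (recv a ρ l P')
  | congr_sendAuth {N : Type w} (a : N) (ρ : QRole R) (l : L) (σ : QRole R)
      {P P' : Proc L R N} :
      SCong P P' → SCong (sendAuth a ρ l σ P) (sendAuth a ρ l σ P')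
  | congr_recvAuth {N : Type w} (a : N) (ρ : QRole R) (l : L) (r : R) {P P' : Proc L R N} :
      SCong P P' → SCong (recvAuth a ρ l r P) (recvAuth a ρ l r P')

/-- The reduction relation `→`. -/
inductive Red : {N : Type w} → Proc L R N → Proc L R N → Prop
  | comm {N : Type w} (a : N) (s r : R) (l : L) (b : N) (P : Proc L R N)
      (Q : Proc L R (Option N)) :
      Red (par (send a (.auth s) l b P) (recv a (.auth r) l Q)) (par P (Q.subst b))
  | auth {N : Type w} (a : N) (s r : R) (l : L) (q : R) (P Q : Proc L R N) :
      Red (par (sendAuth a (.auth s) l (.auth q) P) (recvAuth a (.auth r) l q Q))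
        (par P (Q.authorize a q))
  | par {N : Type w} {P P' : Proc L R N} (Q : Proc L R N) :
      Red P P' → Red (par P Q) (par P' Q)
  | res {N : Type w} {P P' : Proc L R (Option N)} : Red P P' → Red (res P) (res P')
  | struct {N : Type w} {P P' Q' Q : Proc L R N} :
      SCong P P' → Red P' Q' → SCong Q' Q → Red P Q

/-- The reflexive and transitive closure `→*`. -/
def Reds {N : Type w} : Proc L R N → Proc L R N → Prop := Relation.ReflTransGen Red

/-- `P` is of the form `α.Q` with `α` an unauthorized prefix: the subject of `α` carries an
unauthorized role, or `α` sends an unauthorized role. -/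
inductive UnauthPrefix : {N : Type w} → Proc L R N → Prop
  | recv {N : Type w} (a : N) (r : R) (l : L) (Q : Proc L R (Option N)) :
      UnauthPrefix (recv a (.unauth r) l Q)
  | send {N : Type w} (a : N) (r : R) (l : L) (b : N) (Q : Proc L R N) :
      UnauthPrefix (send a (.unauth r) l b Q)
  | recvAuth {N : Type w} (a : N) (r : R) (l : L) (s : R) (Q : Proc L R N) :
      UnauthPrefix (recvAuth a (.unauth r) l s Q)
  | sendAuth {N : Type w} (a : N) (r : R) (l : L) (s : R) (Q : Proc L R N) :
      UnauthPrefix (sendAuth a (.unauth r) l (.auth s) Q)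
  | sendUnauth {N : Type w} (a : N) (σ : QRole R) (l : L) (s : R) (Q : Proc L R N) :
      UnauthPrefix (sendAuth a σ l (.unauth s) Q)

/-- The processes `(ν a₁)⋯(ν aₙ)(α.Q | R)` with `n ≥ 0` and `α` an unauthorized prefix. -/
inductive ErrorForm : {N : Type w} → Proc L R N → Prop
  | top {N : Type w} {P : Proc L R N} (S : Proc L R N) : UnauthPrefix P → ErrorForm (par P S)
  | res {N : Type w} {P : Proc L R (Option N)} : ErrorForm P → ErrorForm (res P)

/-- Authorization errors. -/
def AuthError {N : Type w} (P : Proc L R N) : Prop :=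
  ∃ P' : Proc L R N, SCong P P' ∧ ErrorForm P'

end Proc

/-! ## Conversation types -/

/-- Communication capabilities: output `!r`, input `?r`, message exchange `r → s`. -/
inductive Pol (R : Type v) : Type v
  | out (r : R) : Pol R
  | inp (r : R) : Pol R
  | sync (r s : R) : Pol R

mutual

/-- Behavioral types `B`. -/
inductive Beh (L : Type u) (R : Type v) : Type (max u v)
  /-- `end` -/
  | fin : Beh L R
  /-- `B | C` -/
  | par (B C : Beh L R) : Beh L R
  /-- the sometime type `◇ B` -/
  | dia (B : Beh L R) : Beh L R
  /-- `p l(M).B` -/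
  | act (p : Pol R) (l : L) (M : MsgTy L R) (B : Beh L R) : Beh L R

/-- Shared channel types `T = l(B)`. -/
inductive ShTy (L : Type u) (R : Type v) : Type (max u v)
  | mk (l : L) (B : Beh L R) : ShTy L R

/-- Message types `M`. -/
inductive MsgTy (L : Type u) (R : Type v) : Type (max u v)
  | beh (B : Beh L R) : MsgTy L R
  | shared (T : ShTy L R) : MsgTy L R
  | role (r : R) : MsgTy L R

end

namespace Beh

variable {L : Type u} {R : Type v}

/-- The message labels on which a behavior communicates. -/
def labels : Beh L R → Set L
  | fin => ∅
  | par B C => B.labels ∪ C.labels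
  | dia B => B.labels
  | act _ l _ B => {l} ∪ B.labels

/-- Type apartness `B # C`. -/
def Apart (B C : Beh L R) : Prop := Disjoint B.labels C.labels

/-- No immediate action of the type is a message exchange `r → s`. -/
def NoSync : Beh L R → Prop
  | fin => True
  | par B C => B.NoSync ∧ C.NoSync
  | dia B => B.NoSync
  | act (.out _) _ _ _ => True
  | act (.inp _) _ _ _ => True
  | act (.sync _ _) _ _ _ => False

/-- `matched(B)`: there are no output and no input prefixes in `B`. -/
def Matched : Beh L R → Prop
  | fin => True
  | par B C => B.Matched ∧ C.Matched
  | dia B => B.Matched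
  | act (.out _) _ _ _ => False
  | act (.inp _) _ _ _ => False
  | act (.sync _ _) _ _ B => B.Matched

/-- Equivalence of behavioral types: parallel composition is a commutative monoid with unit `end`,
and `◇` is idempotent and distributes over parallel composition. -/
inductive Equiv : Beh L R → Beh L R → Prop
  | refl (B : Beh L R) : Equiv B B
  | symm {B C : Beh L R} : Equiv B C → Equiv C B
  | trans {B C D : Beh L R} : Equiv B C → Equiv C D → Equiv B D
  | par_fin (B : Beh L R) : Equiv (par B fin) B
  | par_comm (B C : Beh L R) : Equiv (par B C) (par C B)
  | par_assoc (B C D : Beh L R) : Equiv (par (par B C) D) (par B (par C D))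
  | dia_fin : Equiv (dia fin) fin
  | dia_dia (B : Beh L R) : Equiv (dia (dia B)) (dia B)
  | dia_par (B C : Beh L R) : Equiv (dia (par B C)) (par (dia B) (dia C))
  | congr_par {B B' C C' : Beh L R} : Equiv B B' → Equiv C C' → Equiv (par B C) (par B' C')
  | congr_dia {B B' : Beh L R} : Equiv B B' → Equiv (dia B) (dia B')
  | congr_act (p : Pol R) (l : L) (M : MsgTy L R) {B B' : Beh L R} :
      Equiv B B' → Equiv (act p l M B) (act p l M B')

/-- Subtyping `B <: C`: an output or input that is available immediately may be used where it
is expected to take place sometime. -/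
inductive Sub : Beh L R → Beh L R → Prop
  | of_equiv {B C : Beh L R} : Equiv B C → Sub B C
  | trans {B C D : Beh L R} : Sub B C → Sub C D → Sub B D
  | out_dia (r : R) (l : L) (M : MsgTy L R) (B : Beh L R) :
      Sub (act (.out r) l M B) (dia (act (.out r) l M B))
  | inp_dia (r : R) (l : L) (M : MsgTy L R) (B : Beh L R) :
      Sub (act (.inp r) l M B) (dia (act (.inp r) l M B))
  | congr_par {B B' C C' : Beh L R} : Sub B B' → Sub C C' → Sub (par B C) (par B' C')
  | congr_dia {B B' : Beh L R} : Sub B B' → Sub (dia B) (dia B')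
  | congr_act (p : Pol R) (l : L) (M : MsgTy L R) {B B' : Beh L R} :
      Sub B B' → Sub (act p l M B) (act p l M B')

/-- Type splitting: `Split B C D` is `B = C ∘ D`. A message exchange splits into the output and the
input that realize it; alternatively one side keeps a whole prefix `p l(M)`, and the part of
the continuation that goes to the other side takes place sometime later there, on labels
different from `l`. -/
inductive Split : Beh L R → Beh L R → Beh L R → Prop
  | fin (B : Beh L R) : Split B B fin
  | comm {B C D : Beh L R} : Split B C D → Split B D C
  | equiv {B B' C C' D D' : Beh L R} :
      Equiv B B' → Equiv C C' → Equiv D D' → Split B' C' D' → Split B C D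
  | par {B B' C C' D D' : Beh L R} :
      Split B C D → Split B' C' D' → Split (par B B') (par C C') (par D D')
  | dia {B C D : Beh L R} : Split B C D → Split (dia B) (dia C) (dia D)
  | sync (r s : R) (l : L) (M : MsgTy L R) {B C D : Beh L R} :
      Split B C D → Split (act (.sync r s) l M B) (act (.out r) l M C) (act (.inp s) l M D)
  | act (p : Pol R) (l : L) (M : MsgTy L R) {B C D : Beh L R} :
      l ∉ D.labels → Split B C D → Split (act p l M B) (act p l M C) (dia D)

end Beh

mutual

/-- Well-formed types: parallel behaviors are apart, and `◇` is not applied to message exchanges. -/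
def Beh.WF {L : Type u} {R : Type v} : Beh L R → Prop
  | .fin => True
  | .par B C => B.WF ∧ C.WF ∧ Beh.Apart B C
  | .dia B => B.WF ∧ B.NoSync
  | .act _ _ M B => M.WF ∧ B.WF

/-- Well-formed shared channel types. -/
def ShTy.WF {L : Type u} {R : Type v} : ShTy L R → Prop
  | .mk _ B => B.WF

/-- Well-formed message types. -/
def MsgTy.WF {L : Type u} {R : Type v} : MsgTy L R → Prop
  | .beh B => B.WF
  | .shared T => T.WF
  | .role _ => True

end

/-! ## Type environments -/

/-- Type environments: partial maps from channel names to types. -/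
abbrev Env (N : Type w) (A : Type u) := N → Option A

namespace Env

variable {N : Type w} {A : Type u} {L : Type u} {R : Type v}

/-- The domain of an environment. -/
def dom (Δ : Env N A) : Set N := {a | (Δ a).isSome}

open Classical in
/-- The environment `a : t`. -/
noncomputable def single (a : N) (t : A) : Env N A := fun c => if c = a then some t else none

/-- The environment `Δ, x : t` in the scope of the new name `x`. -/
def ext (Δ : Env N A) (t : A) : Env (Option N) A
  | none => some t
  | some a => Δ a

/-- The environment `Δ` in the scope of a new name that has no type in it. -/
def lift (Δ : Env N A) : Env (Option N) A
  | none => none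
  | some a => Δ a

/-- Splitting of single entries; an entry may also go to one side as it is. -/
inductive SplitAt : Option (Beh L R) → Option (Beh L R) → Option (Beh L R) → Prop
  | none : SplitAt none none none
  | left (B : Beh L R) : SplitAt (some B) (some B) none
  | right (B : Beh L R) : SplitAt (some B) none (some B)
  | both {B C D : Beh L R} : Beh.Split B C D → SplitAt (some B) (some C) (some D)

/-- `Split Δ Δ₁ Δ₂` is `Δ = Δ₁ ∘ Δ₂`. -/
def Split (Δ Δ₁ Δ₂ : Env N (Beh L R)) : Prop := ∀ a, SplitAt (Δ a) (Δ₁ a) (Δ₂ a)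

/-- The pair `Δ; Γ` separates linear and shared channels, and all its types are well formed. -/
def Valid (Δ : Env N (Beh L R)) (Γ : Env N (ShTy L R)) : Prop :=
  Disjoint Δ.dom Γ.dom ∧ (∀ a B, Δ a = some B → B.WF) ∧ (∀ a T, Γ a = some T → T.WF)

end Env

/-! ## Typing -/

/-- `unauth(a, ρ)`: the pair `(a, r)` if `ρ` is the unauthorized role `r`, and nothing otherwise. -/
def unauthSet {N : Type w} {R : Type v} (a : N) : QRole R → Set (N × R)
  | .auth _ => ∅
  | .unauth r => {(a, r)}

/-- The set `Σ` of pairs, seen in the scope of a new name, which does not occur in it. -/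
def liftAuth {N : Type w} {R : Type v} (A : Set (N × R)) : Set (Option N × R) :=
  Prod.map some id '' A

/-- The typing judgment `Δ; Γ ⊢_Σ P`. Premises on a process under a binder with the authorization
set `liftAuth Σ` say that this set is `Σ` and that the bound name is not among its channels; in
the rule for shared restriction this is no additional condition, since the channels of an
authorization set are always in the domain of the linear environment. -/
inductive Typed {L : Type u} {R : Type v} : {N : Type w} →
    Env N (Beh L R) → Env N (ShTy L R) → Set (N × R) → Proc L R N → Prop
  | t_end {N : Type w} {Δ : Env N (Beh L R)} {Γ : Env N (ShTy L R)}
      (hv : Env.Valid Δ Γ) (hend : ∀ a B, Δ a = some B → Beh.Equiv B .fin) :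
      Typed Δ Γ ∅ .nil
  | t_new {N : Type w} {Δ : Env N (Beh L R)} {Γ : Env N (ShTy L R)} {S : Set (N × R)}
      {B : Beh L R} {P : Proc L R (Option N)}
      (hv : Env.Valid Δ Γ)
      (hP : Typed (Env.ext Δ B) (Env.lift Γ) (liftAuth S) P) (hB : B.Matched) :
      Typed Δ Γ S (.res P)
  | t_snew {N : Type w} {Δ : Env N (Beh L R)} {Γ : Env N (ShTy L R)} {S : Set (N × R)}
      {l : L} {B : Beh L R} {P : Proc L R (Option N)}
      (hv : Env.Valid Δ Γ)
      (hP : Typed (Env.lift Δ) (Env.ext Γ (.mk l B)) (liftAuth S) P) :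
      Typed Δ Γ S (.res P)
  | t_par {N : Type w} {Δ Δ₁ Δ₂ : Env N (Beh L R)} {Γ : Env N (ShTy L R)}
      {S X Y : Set (N × R)} {P Q : Proc L R N}
      (hv : Env.Valid Δ Γ) (hΔ : Env.Split Δ Δ₁ Δ₂)
      (hP : Typed Δ₁ Γ S P) (hQ : Typed Δ₂ Γ X Q) (hY : Y = S ∪ X) :
      Typed Δ Γ Y (.par P Q)
  | t_role_in {N : Type w} {Δ Δ' Δ₀ : Env N (Beh L R)} {Γ : Env N (ShTy L R)}
      {S X : Set (N × R)} {a : N} {ρ : QRole R} {l : L} {s : R} {B B' : Beh L R}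
      {P : Proc L R N}
      (hv : Env.Valid Δ Γ) (hΔ : Env.Split Δ Δ₀ (Env.single a B'))
      (hΔ' : Env.Split Δ' Δ₀ (Env.single a B))
      (hP : Typed Δ' Γ (S ∪ {(a, s)}) P)
      (hsub : Beh.Sub (.act (.inp ρ.role) l (.role s) B) B')
      (hX : X = S ∪ unauthSet a ρ) :
      Typed Δ Γ X (.recvAuth a ρ l s P)
  | t_role_out {N : Type w} {Δ Δ' Δ₀ : Env N (Beh L R)} {Γ : Env N (ShTy L R)}
      {S X : Set (N × R)} {a : N} {ρ σ : QRole R} {l : L} {B B' : Beh L R}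
      {P : Proc L R N}
      (hv : Env.Valid Δ Γ) (hΔ : Env.Split Δ Δ₀ (Env.single a B'))
      (hΔ' : Env.Split Δ' Δ₀ (Env.single a B))
      (hP : Typed Δ' Γ S P)
      (hsub : Beh.Sub (.act (.out ρ.role) l (.role σ.role) B) B')
      (hX : X = S ∪ unauthSet a ρ ∪ unauthSet a σ) :
      Typed Δ Γ X (.sendAuth a ρ l σ P)
  | t_in {N : Type w} {Δ Δ' Δ₀ : Env N (Beh L R)} {Γ : Env N (ShTy L R)}
      {S X : Set (N × R)} {a : N} {ρ : QRole R} {l : L} {B B' B'' : Beh L R}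
      {P : Proc L R (Option N)}
      (hv : Env.Valid Δ Γ) (hΔ : Env.Split Δ Δ₀ (Env.single a B''))
      (hΔ' : Env.Split Δ' Δ₀ (Env.single a B))
      (hP : Typed (Env.ext Δ' B') (Env.lift Γ) (liftAuth S) P)
      (hsub : Beh.Sub (.act (.inp ρ.role) l (.beh B') B) B'')
      (hX : X = S ∪ unauthSet a ρ) :
      Typed Δ Γ X (.recv a ρ l P)
  | t_out {N : Type w} {Δ Δ₁ Δ' Δ₀ : Env N (Beh L R)} {Γ : Env N (ShTy L R)}
      {S X : Set (N × R)} {a b : N} {ρ : QRole R} {l : L} {B B' B'' : Beh L R}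
      {P : Proc L R N}
      (hv : Env.Valid Δ Γ) (hΔ : Env.Split Δ Δ₁ (Env.single b B'))
      (hΔ₁ : Env.Split Δ₁ Δ₀ (Env.single a B''))
      (hΔ' : Env.Split Δ' Δ₀ (Env.single a B))
      (hP : Typed Δ' Γ S P)
      (hsub : Beh.Sub (.act (.out ρ.role) l (.beh B') B) B'')
      (hX : X = S ∪ unauthSet a ρ) :
      Typed Δ Γ X (.send a ρ l b P)
  | t_lsin {N : Type w} {Δ Δ' Δ₀ : Env N (Beh L R)} {Γ : Env N (ShTy L R)}
      {S X : Set (N × R)} {a : N} {ρ : QRole R} {l : L} {B B' : Beh L R} {T : ShTy L R}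
      {P : Proc L R (Option N)}
      (hv : Env.Valid Δ Γ) (hΔ : Env.Split Δ Δ₀ (Env.single a B))
      (hΔ' : Env.Split Δ' Δ₀ (Env.single a B'))
      (hP : Typed (Env.lift Δ') (Env.ext Γ T) (liftAuth S) P)
      (hsub : Beh.Sub (.act (.inp ρ.role) l (.shared T) B') B)
      (hX : X = S ∪ unauthSet a ρ) :
      Typed Δ Γ X (.recv a ρ l P)
  | t_lsout {N : Type w} {Δ Δ' Δ₀ : Env N (Beh L R)} {Γ : Env N (ShTy L R)}
      {S X : Set (N × R)} {a b : N} {ρ : QRole R} {l : L} {B B' : Beh L R} {T : ShTy L R}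
      {P : Proc L R N}
      (hv : Env.Valid Δ Γ) (hΔ : Env.Split Δ Δ₀ (Env.single a B)) (hb : Γ b = some T)
      (hΔ' : Env.Split Δ' Δ₀ (Env.single a B'))
      (hP : Typed Δ' Γ S P)
      (hsub : Beh.Sub (.act (.out ρ.role) l (.shared T) B') B)
      (hX : X = S ∪ unauthSet a ρ) :
      Typed Δ Γ X (.send a ρ l b P)
  | t_sin {N : Type w} {Δ : Env N (Beh L R)} {Γ : Env N (ShTy L R)}
      {S : Set (N × R)} {a : N} {r : R} {l : L} {B : Beh L R} {P : Proc L R (Option N)}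
      (hv : Env.Valid Δ Γ) (ha : Γ a = some (.mk l B))
      (hP : Typed (Env.ext Δ B) (Env.lift Γ) (liftAuth S) P) :
      Typed Δ Γ S (.recv a (.auth r) l P)
  | t_sout {N : Type w} {Δ Δ' : Env N (Beh L R)} {Γ : Env N (ShTy L R)}
      {S : Set (N × R)} {a b : N} {r : R} {l : L} {B : Beh L R} {P : Proc L R N}
      (hv : Env.Valid Δ Γ) (ha : Γ a = some (.mk l B))
      (hΔ : Env.Split Δ Δ' (Env.single b B))
      (hP : Typed Δ' Γ S P) :
      Typed Δ Γ S (.send a (.auth r) l b P)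

/-- `P` is well typed: `Δ; Γ ⊢_∅ P` for some (finite) environments `Δ` and `Γ`. -/
def WellTyped {L : Type u} {R : Type v} {N : Type w} (P : Proc L R N) : Prop :=
  ∃ (Δ : Env N (Beh L R)) (Γ : Env N (ShTy L R)), Δ.dom.Finite ∧ Γ.dom.Finite ∧ Typed Δ Γ ∅ P

end RoleAuth

/-!
The authorization component of a typing judgment is an invariant of processes by itself: every
unauthorized role in a prefix is listed in the authorization set or guarded by a reception of that
role on the same channel. When a reception of `q` on `a` fires, the continuation can no longer rely
on the pair `(a, q)`, but the reduction replaces exactly the roles that needed it; hence the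
invariant survives reduction with the same set. For the empty set it excludes unauthorized prefixes
that are not under another prefix.
-/

namespace RoleAuth

variable {L : Type u} {R : Type v} {N N' : Type w}

theorem liftAuth_empty : liftAuth (∅ : Set (N × R)) = ∅ :=
  Set.image_empty _

theorem liftAuth_mono {S T : Set (N × R)} (h : S ⊆ T) : liftAuth S ⊆ liftAuth T :=
  Set.image_mono h

theorem liftAuth_insert (a : N) (r : R) (S : Set (N × R)) :
    liftAuth (insert (a, r) S) = insert (some a, r) (liftAuth S) :=
  Set.image_insert_eq

theorem preimage_liftAuth (f : N → N') (S : Set (N' × R)) :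
    Prod.map (Option.map f) id ⁻¹' liftAuth S = liftAuth (Prod.map f id ⁻¹' S) := by
  ext ⟨_ | a, r⟩ <;> simp [liftAuth]

theorem mapsTo_liftAuth {f : N → N'} {S : Set (N × R)} {T : Set (N' × R)}
    (h : Set.MapsTo (Prod.map f id) S T) :
    Set.MapsTo (Prod.map (Option.map f) id) (liftAuth S) (liftAuth T) :=
  (liftAuth_mono h).trans (preimage_liftAuth f T).ge

theorem preimage_some_liftAuth (S : Set (N × R)) : Prod.map some id ⁻¹' liftAuth S = S :=
  Set.preimage_image_eq S ((Option.some_injective N).prodMap Function.injective_id)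

theorem preimage_swapName_liftAuth_liftAuth (S : Set (N × R)) :
    Prod.map Proc.swapName id ⁻¹' liftAuth (liftAuth S) = liftAuth (liftAuth S) := by
  ext ⟨_ | _ | a, r⟩ <;> simp [liftAuth, Proc.swapName]

theorem preimage_insert_of_injective {f : N → N'} (hf : f.Injective) (a : N) (r : R)
    (S : Set (N' × R)) :
    Prod.map f id ⁻¹' insert (f a, r) S = insert (a, r) (Prod.map f id ⁻¹' S) := by
  ext ⟨b, s⟩
  simp [hf.eq_iff]

theorem unauthSet_map (f : N → N') (a : N) (ρ : QRole R) :
    unauthSet (f a) ρ = Prod.map f id '' unauthSet a ρ := by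
  cases ρ <;> simp [unauthSet]

theorem unauthSet_map_subset_iff {f : N → N'} {a : N} {ρ : QRole R} {S : Set (N' × R)} :
    unauthSet (f a) ρ ⊆ S ↔ unauthSet a ρ ⊆ Prod.map f id ⁻¹' S := by
  rw [unauthSet_map, Set.image_subset_iff]

theorem unauthSet_map_subset {f : N → N'} {a : N} {ρ : QRole R} {S : Set (N × R)}
    {T : Set (N' × R)} (hf : Set.MapsTo (Prod.map f id) S T) (h : unauthSet a ρ ⊆ S) :
    unauthSet (f a) ρ ⊆ T :=
  unauthSet_map_subset_iff.mpr (h.trans hf)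

theorem unauthSet_authorizeOn (a : N) (q : R) (c : N) (ρ : QRole R) :
    unauthSet c (Proc.authorizeOn a q c ρ) = unauthSet c ρ \ {(a, q)} := by
  cases ρ with
  | auth r => simp [Proc.authorizeOn, QRole.authorize, unauthSet]
  | unauth r =>
    by_cases h : c = a ∧ r = q
    · simp [Proc.authorizeOn, QRole.authorize, unauthSet, h]
    · have hdisj : Disjoint {(c, r)} ({(a, q)} : Set (N × R)) := by simpa using h
      have hkeep : Proc.authorizeOn a q c (.unauth r) = .unauth r := by
        simpa [Proc.authorizeOn, QRole.authorize] using h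
      rw [hkeep, unauthSet, hdisj.sdiff_eq_left]

theorem unauthSet_authorizeOn_subset_iff {a c : N} {q : R} {ρ : QRole R} {S : Set (N × R)} :
    unauthSet c (Proc.authorizeOn a q c ρ) ⊆ S ↔ unauthSet c ρ ⊆ insert (a, q) S := by
  rw [unauthSet_authorizeOn, Set.sdiff_singleton_subset_iff]

namespace Proc

/-- `P` is authorized up to `S`: every unauthorized role `r` in a prefix of `P` on the channel `a`
is either listed as `(a, r)` in `S` or under a prefix on `a` that receives the authorization for
`r`. This is the invariant behind type safety. As in the typing rules, `S` is passed under a binder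
as `liftAuth S`, so that it never provides authorizations on a bound channel. -/
def AuthorizedUpTo : {N : Type w} → Set (N × R) → Proc L R N → Prop
  | _, _, nil => True
  | _, S, par P Q => P.AuthorizedUpTo S ∧ Q.AuthorizedUpTo S
  | _, S, res P => P.AuthorizedUpTo (liftAuth S)
  | _, S, send a ρ _ _ P => unauthSet a ρ ⊆ S ∧ P.AuthorizedUpTo S
  | _, S, recv a ρ _ P => unauthSet a ρ ⊆ S ∧ P.AuthorizedUpTo (liftAuth S)
  | _, S, sendAuth a ρ _ σ P =>
      unauthSet a ρ ⊆ S ∧ unauthSet a σ ⊆ S ∧ P.AuthorizedUpTo S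
  | _, S, recvAuth a ρ _ r P => unauthSet a ρ ⊆ S ∧ P.AuthorizedUpTo (insert (a, r) S)

theorem AuthorizedUpTo.map {P : Proc L R N} {f : N → N'} {S : Set (N × R)} {T : Set (N' × R)}
    (h : P.AuthorizedUpTo S) (hf : Set.MapsTo (Prod.map f id) S T) :
    (P.map f).AuthorizedUpTo T := by
  induction P generalizing N' with
  | nil => trivial
  | par P Q ihP ihQ => exact ⟨ihP h.1 hf, ihQ h.2 hf⟩
  | res P ih => exact ih (S := liftAuth S) h (mapsTo_liftAuth hf)
  | send a ρ l b P ih => exact ⟨unauthSet_map_subset hf h.1, ih h.2 hf⟩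
  | recv a ρ l P ih => exact ⟨unauthSet_map_subset hf h.1, ih h.2 (mapsTo_liftAuth hf)⟩
  | sendAuth a ρ l σ P ih =>
    exact ⟨unauthSet_map_subset hf h.1, unauthSet_map_subset hf h.2.1, ih h.2.2 hf⟩
  | recvAuth a ρ l r P ih => exact ⟨unauthSet_map_subset hf h.1, ih h.2 (hf.insert (a, r))⟩

theorem AuthorizedUpTo.of_map {P : Proc L R N} {f : N → N'} (hf : f.Injective)
    {S : Set (N' × R)} (h : (P.map f).AuthorizedUpTo S) :
    P.AuthorizedUpTo (Prod.map f id ⁻¹' S) := by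
  induction P generalizing N' with
  | nil => trivial
  | par P Q ihP ihQ => exact ⟨ihP hf h.1, ihQ hf h.2⟩
  | res P ih =>
    rw [AuthorizedUpTo, ← preimage_liftAuth]
    exact ih (Option.map_injective hf) h
  | send a ρ l b P ih => exact ⟨unauthSet_map_subset_iff.mp h.1, ih hf h.2⟩
  | recv a ρ l P ih =>
    rw [AuthorizedUpTo, ← preimage_liftAuth]
    exact ⟨unauthSet_map_subset_iff.mp h.1, ih (Option.map_injective hf) h.2⟩
  | sendAuth a ρ l σ P ih =>
    exact ⟨unauthSet_map_subset_iff.mp h.1, unauthSet_map_subset_iff.mp h.2.1, ih hf h.2.2⟩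
  | recvAuth a ρ l r P ih =>
    rw [AuthorizedUpTo, ← preimage_insert_of_injective hf]
    exact ⟨unauthSet_map_subset_iff.mp h.1, ih hf h.2⟩

theorem authorizedUpTo_map_iff {P : Proc L R N} {f : N → N'} (hf : f.Injective)
    {S : Set (N' × R)} :
    (P.map f).AuthorizedUpTo S ↔ P.AuthorizedUpTo (Prod.map f id ⁻¹' S) :=
  ⟨.of_map hf, fun h => h.map (Set.mapsTo_preimage _ _)⟩

theorem AuthorizedUpTo.mono {P : Proc L R N} {S T : Set (N × R)} (h : P.AuthorizedUpTo S)
    (hST : S ⊆ T) : P.AuthorizedUpTo T :=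
  -- Rename along `id`, enlarging the set on the way, and reflect back.
  .of_map Function.injective_id (h.map hST)

theorem authorizedUpTo_lift_iff {P : Proc L R N} {S : Set (N × R)} :
    P.lift.AuthorizedUpTo (liftAuth S) ↔ P.AuthorizedUpTo S := by
  rw [lift, authorizedUpTo_map_iff (Option.some_injective N), preimage_some_liftAuth]

theorem swapName_involutive : Function.Involutive (swapName (N := N)) := by
  rintro (_ | _ | a) <;> rfl

theorem authorizedUpTo_map_swapName_iff {P : Proc L R (Option (Option N))} {S : Set (N × R)} :
    (P.map swapName).AuthorizedUpTo (liftAuth (liftAuth S)) ↔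
      P.AuthorizedUpTo (liftAuth (liftAuth S)) := by
  rw [authorizedUpTo_map_iff swapName_involutive.injective, preimage_swapName_liftAuth_liftAuth]

theorem SCong.authorizedUpTo_iff {P Q : Proc L R N} (h : SCong P Q) {S : Set (N × R)} :
    P.AuthorizedUpTo S ↔ Q.AuthorizedUpTo S := by
  induction h with
  | refl => rfl
  | symm _ ih => exact ih.symm
  | trans _ _ ih₁ ih₂ => exact ih₁.trans ih₂
  | par_nil => exact iff_of_eq (and_true _)
  | par_comm => exact and_comm
  | par_assoc => exact and_assoc
  | res_nil => rfl
  | res_swap => exact authorizedUpTo_map_swapName_iff.symm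
  | res_par => exact and_congr_right' authorizedUpTo_lift_iff.symm
  | congr_par _ _ ih₁ ih₂ => exact and_congr ih₁ ih₂
  | congr_res _ ih => exact ih
  | congr_send _ _ _ _ _ ih | congr_recv _ _ _ _ ih | congr_recvAuth _ _ _ _ _ ih =>
    exact and_congr_right' ih
  | congr_sendAuth _ _ _ _ _ ih => exact and_congr_right' (and_congr_right' ih)

theorem AuthorizedUpTo.subst {P : Proc L R (Option N)} {S : Set (N × R)}
    (h : P.AuthorizedUpTo (liftAuth S)) (b : N) : (P.subst b).AuthorizedUpTo S := by
  refine h.map ?_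
  rintro _ ⟨x, hx, rfl⟩
  exact hx

theorem authorizedUpTo_authorize_iff {P : Proc L R N} {S : Set (N × R)} {a : N} {q : R} :
    (P.authorize a q).AuthorizedUpTo S ↔ P.AuthorizedUpTo (insert (a, q) S) := by
  induction P with
  | nil => rfl
  | par P Q ihP ihQ => exact and_congr ihP ihQ
  | res P ih =>
    rw [AuthorizedUpTo, liftAuth_insert]
    exact ih
  | send c ρ _ _ P ih => exact and_congr unauthSet_authorizeOn_subset_iff ih
  | recv c ρ _ P ih =>
    rw [AuthorizedUpTo, liftAuth_insert]
    exact and_congr unauthSet_authorizeOn_subset_iff ih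
  | sendAuth c ρ _ σ P ih =>
    exact and_congr unauthSet_authorizeOn_subset_iff
      (and_congr unauthSet_authorizeOn_subset_iff ih)
  | recvAuth c ρ l r P ih =>
    rw [AuthorizedUpTo, Set.insert_comm]
    exact and_congr unauthSet_authorizeOn_subset_iff ih

theorem Red.authorizedUpTo {P Q : Proc L R N} (h : Red P Q) {S : Set (N × R)}
    (hP : P.AuthorizedUpTo S) : Q.AuthorizedUpTo S := by
  induction h with
  | comm a s r l b P Q =>
    obtain ⟨⟨-, hP⟩, -, hQ⟩ := hP
    exact ⟨hP, AuthorizedUpTo.subst hQ b⟩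
  | auth a s r l q P Q =>
    obtain ⟨⟨-, -, hP⟩, -, hQ⟩ := hP
    exact ⟨hP, authorizedUpTo_authorize_iff.mpr hQ⟩
  | par Q _ ih => exact ⟨ih hP.1, hP.2⟩
  | res _ ih => exact ih (S := liftAuth S) hP
  | struct h₁ _ h₂ ih => exact h₂.authorizedUpTo_iff.mp (ih (h₁.authorizedUpTo_iff.mp hP))

theorem Reds.authorizedUpTo {P Q : Proc L R N} (h : Reds P Q) {S : Set (N × R)}
    (hP : P.AuthorizedUpTo S) : Q.AuthorizedUpTo S := by
  induction h with
  | refl => exact hP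
  | tail _ h ih => exact h.authorizedUpTo ih

theorem UnauthPrefix.not_authorizedUpTo_empty {P : Proc L R N} (h : UnauthPrefix P) :
    ¬ P.AuthorizedUpTo ∅ := by
  cases h <;> simp [AuthorizedUpTo, unauthSet]

theorem ErrorForm.not_authorizedUpTo_empty {P : Proc L R N} (h : ErrorForm P) :
    ¬ P.AuthorizedUpTo ∅ := by
  induction h with
  | top S h => exact fun hP => h.not_authorizedUpTo_empty hP.1
  | res _ ih => rwa [AuthorizedUpTo, liftAuth_empty]

theorem AuthError.not_authorizedUpTo_empty {P : Proc L R N} (h : AuthError P) :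
    ¬ P.AuthorizedUpTo ∅ := by
  obtain ⟨P', hPP', hP'⟩ := h
  exact fun hP => hP'.not_authorizedUpTo_empty (hPP'.authorizedUpTo_iff.mp hP)

end Proc

theorem Typed.authorizedUpTo {Δ : Env N (Beh L R)} {Γ : Env N (ShTy L R)} {S : Set (N × R)}
    {P : Proc L R N} (h : Typed Δ Γ S P) : P.AuthorizedUpTo S := by
  induction h with
  | t_end => trivial
  | t_new _ _ _ ih | t_snew _ _ ih => exact ih
  | t_par _ _ _ _ hY ihP ihQ =>
    subst hY
    exact ⟨ihP.mono Set.subset_union_left, ihQ.mono Set.subset_union_right⟩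
  | t_role_in _ _ _ _ _ hX ih =>
    subst hX
    rw [Set.union_singleton] at ih
    exact ⟨Set.subset_union_right, ih.mono (Set.insert_subset_insert Set.subset_union_left)⟩
  | t_role_out _ _ _ _ _ hX ih =>
    subst hX
    exact ⟨Set.subset_union_right.trans Set.subset_union_left, Set.subset_union_right,
      ih.mono (Set.subset_union_left.trans Set.subset_union_left)⟩
  | t_in _ _ _ _ _ hX ih | t_lsin _ _ _ _ _ hX ih =>
    subst hX
    exact ⟨Set.subset_union_right, ih.mono (liftAuth_mono Set.subset_union_left)⟩
  | t_out _ _ _ _ _ _ hX ih | t_lsout _ _ _ _ _ _ hX ih =>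
    subst hX
    exact ⟨Set.subset_union_right, ih.mono Set.subset_union_left⟩
  | t_sin _ _ _ ih | t_sout _ _ _ _ ih => exact ⟨Set.empty_subset _, ih⟩

end RoleAuth

theorem mainTheorem1_general {L : Type*} {R : Type*} {N : Type*} {P Q : RoleAuth.Proc L R N}
    (hP : P.AuthorizedUpTo ∅) (hPQ : RoleAuth.Proc.Reds P Q) :
    ¬ RoleAuth.Proc.AuthError Q :=
  fun hQ => hQ.not_authorizedUpTo_empty (hPQ.authorizedUpTo hP)

theorem mainTheorem1 {L : Type*} {R : Type*} {N : Type*} (P Q : RoleAuth.Proc L R N)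
    (hP : RoleAuth.WellTyped P) (hPQ : RoleAuth.Proc.Reds P Q) :
    ¬ RoleAuth.Proc.AuthError Q := by
  obtain ⟨_, _, -, -, hTyped⟩ := hP
  exact mainTheorem1_general hTyped.authorizedUpTo hPQ
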